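/- Let $p$ be a prime, $n \ge 0$ and $N = p^n = |\mathbb{F}_p^n|$. A triangle in $\mathbb{F}_p^n$ is an ordered triple $(x,y,z)$ of points with $x+y+z=0$. Let $c_p \in (0,1)$ be the constant given by $$p^{1-c_p} = \inf_{0<x<1} x^{-(p-1)/3}\left(1+x+\cdots+x^{p-1}\right),$$ and let $C_p = 1+1/c_p$. Suppose that $(x_i,y_i,z_i)$, $1 \le i \le m$, are $m=\epsilon N$ disjoint triangles in $\mathbb{F}_p^n$, where it is enough that they are disjoint in each coordinate: $x_i \ne x_j$, $y_i \ne y_j$ and $z_i \ne z_j$ whenever $i \ne j$. Then, for $X=\{x_i\}_{i=1}^m$, $Y=\{y_i\}_{i=1}^m$ and $Z=\{z_i\}_{i=1}^m$, the set $X \times Y \times Z$ contains at least $\epsilon^{C_p} N^2$ triangles. -/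

import Mathlib

open Finset

/-- The function `x ↦ x^{-(p-1)/3} (x^0 + x^1 + ⋯ + x^{p-1})` whose infimum over `0 < x < 1`
defines the constant `c_p`. -/
noncomputable def rateFun (p : ℕ) (x : ℝ) : ℝ :=
  x ^ (-((p : ℝ) - 1) / 3) * ∑ i ∈ Finset.range p, x ^ i

/-- The infimum of `rateFun p` over the open interval `(0, 1)`. -/
noncomputable def rateInf (p : ℕ) : ℝ :=
  sInf (rateFun p '' Set.Ioo (0 : ℝ) 1)

/-- The constant `c_p`, determined by `p ^ (1 - c_p) = rateInf p`
(see `rpow_one_sub_smallC`). -/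
noncomputable def smallC (p : ℕ) : ℝ :=
  1 - Real.logb p (rateInf p)

/-- The exponent `C_p = 1 + 1 / c_p`. -/
noncomputable def bigC (p : ℕ) : ℝ :=
  1 + 1 / smallC p

/-- A triangle in an additive group is an ordered triple `(x, y, z)` with `x + y + z = 0`. -/
def IsTriangle {V : Type*} [AddCommGroup V] (t : V × V × V) : Prop :=
  t.1 + t.2.1 + t.2.2 = 0

open Classical in
/-- The finite set of all triangles contained in `X × Y × Z`. -/
noncomputable def trianglesIn {V : Type*} [AddCommGroup V] (X Y Z : Finset V) :
    Finset (V × V × V) :=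
  (X ×ˢ Y ×ˢ Z).filter IsTriangle

/-- Disjointness of two triangles as transversals of the three (coloured) vertex classes: they
share no first point, no second point and no third point. -/
def TriangleDisjoint {V : Type*} (s t : V × V × V) : Prop :=
  s.1 ≠ t.1 ∧ s.2.1 ≠ t.2.1 ∧ s.2.2 ≠ t.2.2

/-! The infimum is a genuine one and `0 < c_p < 1`, so that no junk value enters. -/

theorem rateFun_lower {p : ℕ} (hp : 2 ≤ p) {x : ℝ} (hx : x ∈ Set.Ioo (0 : ℝ) 1) :
    6 / 5 ≤ rateFun p x := by
  obtain ⟨h0, h1⟩ := hx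
  have hp' : (2 : ℝ) ≤ p := by exact_mod_cast hp
  have hsum : 1 + x ≤ ∑ i ∈ Finset.range p, x ^ i := by
    have h := Finset.sum_le_sum_of_subset_of_nonneg (f := fun i : ℕ => x ^ i)
      (Finset.range_subset_range.2 hp) (fun i _ _ => by positivity)
    simpa [Finset.sum_range_succ] using h
  have hpow : x ^ (-(1 : ℝ) / 3) ≤ x ^ (-((p : ℝ) - 1) / 3) :=
    Real.rpow_le_rpow_of_exponent_ge h0 h1.le (by linarith)
  have hone : 1 ≤ x ^ (-(1 : ℝ) / 3) :=
    Real.one_le_rpow_of_pos_of_le_one_of_nonpos h0 h1.le (by norm_num)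
  unfold rateFun
  have hmain : 6 / 5 ≤ x ^ (-(1 : ℝ) / 3) * (1 + x) := by
    rcases le_total x (1 / 2) with h | h
    · have hcube : (x ^ (-(1 : ℝ) / 3)) ^ 3 * x = 1 := by
        rw [← Real.rpow_natCast, ← Real.rpow_mul h0.le]
        norm_num
        rw [Real.rpow_neg_one, inv_mul_cancel₀ h0.ne']
      set u := x ^ (-(1 : ℝ) / 3)
      have hu : 6 / 5 ≤ u := by
        by_contra! hlt
        have : u ^ 3 ≤ (6 / 5) ^ 3 := by gcongr
        nlinarith
      nlinarith
    · nlinarith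
  calc (6 / 5 : ℝ) ≤ x ^ (-(1 : ℝ) / 3) * (1 + x) := hmain
    _ ≤ _ := by gcongr

theorem isGLB_rateInf {p : ℕ} (hp : 2 ≤ p) :
    IsGLB (rateFun p '' Set.Ioo (0 : ℝ) 1) (rateInf p) := by
  refine isGLB_csInf ?_ ?_
  · exact Set.Nonempty.image _ ⟨1 / 2, by norm_num, by norm_num⟩
  · refine ⟨6 / 5, ?_⟩
    rintro _ ⟨x, hx, rfl⟩
    exact rateFun_lower hp hx

theorem one_lt_rateInf {p : ℕ} (hp : 2 ≤ p) : 1 < rateInf p := by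
  have h : (6 / 5 : ℝ) ≤ rateInf p := by
    refine (isGLB_rateInf hp).2 ?_
    rintro _ ⟨x, hx, rfl⟩
    exact rateFun_lower hp hx
  linarith

theorem rateInf_lt {p : ℕ} (hp : 2 ≤ p) : rateInf p < p := by
  have hp' : (2 : ℝ) ≤ p := by exact_mod_cast hp
  have hd : HasDerivAt (rateFun p)
      ((-((p : ℝ) - 1) / 3 * (1 : ℝ) ^ (-((p : ℝ) - 1) / 3 - 1)) *
        (∑ i ∈ Finset.range p, (1 : ℝ) ^ i) +
        (1 : ℝ) ^ (-((p : ℝ) - 1) / 3) *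
          ∑ i ∈ Finset.range p, ((i : ℝ) * (1 : ℝ) ^ (i - 1))) 1 := by
    unfold rateFun
    exact (Real.hasDerivAt_rpow_const (Or.inl one_ne_zero)).mul
      (HasDerivAt.fun_sum fun i _ => hasDerivAt_pow i 1)
  have hgauss : (∑ i ∈ Finset.range p, (i : ℝ)) = p * (p - 1) / 2 := by
    have h := Finset.sum_range_id_mul_two p
    have h2 : ((∑ i ∈ Finset.range p, i : ℕ) : ℝ) * 2 = p * ((p - 1 : ℕ) : ℝ) := by
      exact_mod_cast h
    rw [Nat.cast_sub (by omega)] at h2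
    push_cast at h2
    linarith
  simp only [Real.one_rpow, one_pow, mul_one, Finset.sum_const, Finset.card_range,
    nsmul_eq_mul, one_mul, hgauss] at hd
  have hval : rateFun p 1 = p := by simp [rateFun]
  have hpos : 0 < -((p : ℝ) - 1) / 3 * p + p * (p - 1) / 2 := by nlinarith
  have hev := (hasDerivAt_iff_tendsto_slope.1 hd).eventually (lt_mem_nhds hpos)
  have hev' := hev.filter_mono (nhdsWithin_mono 1 (fun x (hx : x < 1) => ne_of_lt hx) :
    nhdsWithin (1 : ℝ) (Set.Iio 1) ≤ _)
  obtain ⟨x, hs, hx⟩ := (hev'.and (Ioo_mem_nhdsLT (zero_lt_one (α := ℝ)))).exists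
  have hlt : rateFun p x < p := by
    rw [slope_def_field, hval] at hs
    have h1 : x - 1 < 0 := by linarith [hx.2]
    by_contra! hge
    exact absurd hs (not_lt.2 (div_nonpos_of_nonneg_of_nonpos (by linarith) h1.le))
  exact lt_of_le_of_lt ((isGLB_rateInf hp).1 ⟨x, hx, rfl⟩) hlt

/-- The defining equation of `c_p`. -/
theorem rpow_one_sub_smallC {p : ℕ} (hp : 2 ≤ p) : (p : ℝ) ^ (1 - smallC p) = rateInf p := by
  have hp' : (2 : ℝ) ≤ p := by exact_mod_cast hp
  rw [smallC, sub_sub_cancel]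
  exact Real.rpow_logb (by linarith) (by linarith) (by linarith [one_lt_rateInf hp])

theorem smallC_mem_Ioo {p : ℕ} (hp : 2 ≤ p) : smallC p ∈ Set.Ioo (0 : ℝ) 1 := by
  have hp' : (1 : ℝ) < p := by exact_mod_cast (show 1 < p by omega)
  have h1 := one_lt_rateInf hp
  have h2 : Real.logb p (rateInf p) < 1 := by
    rw [Real.logb_lt_iff_lt_rpow hp' (by linarith), Real.rpow_one]
    exact rateInf_lt hp
  have h3 : 0 < Real.logb p (rateInf p) := Real.logb_pos hp' h1
  constructor <;> unfold smallC <;> linarith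

/-!
Write `N = |V|` for a finite vector space `V` over `𝔽_p`, write `c = smallC p`, and let `T` be the
number of triangles in `X × Y × Z`.

The polynomial method (`card_le_of_add_eq_zero_iff`) shows that a tri-coloured sum-free set in
`𝔽_p ^ n` has at most `3 (p ^ (1 - c)) ^ n` elements: the indicator of `x + y + z = 0` is a polynomial
of degree at most `(p - 1) n`, so it splits into slices indexed by monomials of degree at most
`(p - 1) n / 3`, whereas a diagonal tensor has full slice rank
(`card_le_three_mul_of_diagonal_eq_sum`).

Suppose that every point lies in at most `d` triangles. Restrict the three sets to random translates
of a random subspace of codimension `k`, where `p ^ k` is about `6 d`. Then a triangle that survives is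
isolated, meaning that no other surviving triangle shares a point with it, with probability at least
`1 / 2`. The isolated triangles form a tri-coloured sum-free set in dimension `n - k`, and averaging
gives `T = O(N ^ (1 - c) d ^ (1 + c))` (`card_trianglesIn_le_of_degree_le`). The random subspace is the
graph of a random matrix, which makes its dimension exact.

Now delete points of maximum degree one at a time. Each deletion destroys at most one of the `m`
given disjoint triangles, and the bound above says that it destroys at least
`(T / (K N ^ (1 - c))) ^ (1 / (1 + c))` triangles, where `T` is the current number and `K` depends on
`p` only. So `T ^ (c / (1 + c))` drops by a fixed amount at each of at least `m` deletions
(`card_mul_le_card_trianglesIn_rpow`), which is the theorem up to a constant factor. Applying this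
to all powers of the configuration removes the constant (`rpow_mul_rpow_le_card_trianglesIn`).
-/

/-! ### Slice rank of a diagonal tensor -/

/-- A subspace of `S → F` of dimension `d` contains a vector with at least `d` nonzero
coordinates. -/
theorem exists_mem_finrank_le_card_support {F S : Type*} [Field F] [DecidableEq F] [Fintype S]
    (W : Submodule F (S → F)) :
    ∃ v ∈ W, Module.finrank F W ≤ #{s | v s ≠ 0} := by
  suffices H : ∀ r ≤ Module.finrank F W, ∃ v ∈ W, r ≤ #{s | v s ≠ 0} from H _ le_rfl
  intro r
  induction r with
  | zero => exact fun _ => ⟨0, W.zero_mem, Nat.zero_le _⟩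
  | succ r ih =>
    intro hr
    obtain ⟨v, hv, hcard⟩ := ih (by omega)
    by_cases hlt : r + 1 ≤ #{s | v s ≠ 0}
    · exact ⟨v, hv, hlt⟩
    -- Some nonzero `w ∈ W` vanishes on the support of `v`; then `v + w` has a larger support.
    let φ : W →ₗ[F] ({s // v s ≠ 0} → F) :=
      (LinearMap.funLeft F F Subtype.val).comp W.subtype
    have hker : LinearMap.ker φ ≠ ⊥ := by
      apply LinearMap.ker_ne_bot_of_finrank_lt
      rw [Module.finrank_fintype_fun_eq_card, Fintype.card_subtype]
      omega
    obtain ⟨w, hw, hw0⟩ := Submodule.exists_mem_ne_zero_of_ne_bot hker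
    have hwv : ∀ s, v s ≠ 0 → (w : S → F) s = 0 := fun s hs => by
      simpa [φ] using congrFun (LinearMap.mem_ker.1 hw) ⟨s, hs⟩
    obtain ⟨s₀, hs₀⟩ : ∃ s, (w : S → F) s ≠ 0 := by
      by_contra! h
      exact hw0 (Subtype.ext (funext h))
    refine ⟨v + w, W.add_mem hv w.2, Nat.succ_le_of_lt (hcard.trans_lt (card_lt_card ?_))⟩
    refine (ssubset_iff_of_subset fun s hs => ?_).2 ⟨s₀, ?_, ?_⟩
    · simp only [mem_filter, mem_univ, true_and] at hs ⊢
      simpa [hwv s hs] using hs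
    · have : v s₀ = 0 := by
        by_contra h
        exact hs₀ (hwv _ h)
      simpa [this] using hs₀
    · simp only [mem_filter, mem_univ, true_and]
      exact fun h => hs₀ (hwv _ h)

/-- The diagonal tensor on `S` has slice rank `|S|`: if it is a combination of products
`f a i * g b j * h c k`, each of which has a factor indexed by an element of `M`, then
`|S| ≤ 3 |M|`. -/
theorem card_le_three_mul_of_diagonal_eq_sum {F S E Λ : Type*} [Field F] [Fintype S]
    [DecidableEq S] [Fintype E] [DecidableEq Λ] (M : Finset Λ) (C : E → F) (α β γ : E → Λ)
    (f g h : Λ → S → F)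
    (hM : ∀ e, C e ≠ 0 → α e ∈ M ∨ β e ∈ M ∨ γ e ∈ M)
    (hdiag : ∀ i j k, ∑ e, C e * f (α e) i * g (β e) j * h (γ e) k =
      if i = j ∧ j = k then 1 else 0) :
    Fintype.card S ≤ 3 * #M := by
  classical
  -- Contract the third variable with a vector `v` of large support orthogonal to all `h c`,
  -- `c ∈ M`. The result is a diagonal matrix of large rank, but it has rank at most `2 |M|`.
  let φ : (S → F) →ₗ[F] (M → F) := Matrix.mulVecLin (Matrix.of fun (c : M) k => h c k)
  obtain ⟨v, hv, hsupp⟩ := exists_mem_finrank_le_card_support (LinearMap.ker φ)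
  have hdim := LinearMap.finrank_range_add_finrank_ker φ
  have hrange := Submodule.finrank_le (LinearMap.range φ)
  rw [Module.finrank_fintype_fun_eq_card] at hdim hrange
  rw [Fintype.card_coe] at hrange
  have horth : ∀ c ∈ M, ∑ k, h c k * v k = 0 := fun c hc => by
    simpa [φ, Matrix.mulVec, dotProduct] using congrFun (LinearMap.mem_ker.1 hv) ⟨c, hc⟩
  let w : E → F := fun e => ∑ k, h (γ e) k * v k
  let A : Matrix S (M ⊕ M) F := Matrix.of fun i c => Sum.elim (fun a : M => f a i)
    (fun b : M => ∑ e, if α e ∉ M ∧ β e = b then C e * f (α e) i * w e else 0) c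
  let B : Matrix (M ⊕ M) S F := Matrix.of fun c j => Sum.elim
    (fun a : M => ∑ e, if α e = a then C e * g (β e) j * w e else 0) (fun b : M => g b j) c
  have hAB : Matrix.diagonal v = A * B := by
    ext i j
    have hL : Matrix.diagonal v i j = ∑ e, C e * f (α e) i * g (β e) j * w e := by
      calc Matrix.diagonal v i j = ∑ k, (if i = j ∧ j = k then 1 else 0) * v k := by
            by_cases hij : i = j <;> simp [hij]
        _ = ∑ k, ∑ e, C e * f (α e) i * g (β e) j * (h (γ e) k * v k) := by
            refine sum_congr rfl fun k _ => ?_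
            rw [← hdiag, sum_mul]
            exact sum_congr rfl fun e _ => by ring
        _ = _ := by
            rw [sum_comm]
            exact sum_congr rfl fun e _ => by rw [mul_sum]
    have hterm : ∀ e, C e * f (α e) i * g (β e) j * w e =
        (∑ a : M, f a i * if α e = a then C e * g (β e) j * w e else 0) +
        ∑ b : M, (if α e ∉ M ∧ β e = b then C e * f (α e) i * w e else 0) * g b j := by
      intro e
      have h1 : (∑ a : M, f a i * if α e = a then C e * g (β e) j * w e else 0) =
          if α e ∈ M then C e * f (α e) i * g (β e) j * w e else 0 := by
        rw [sum_coe_sort M (fun a => f a i * if α e = a then C e * g (β e) j * w e else 0)]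
        simp only [mul_ite, mul_zero, sum_ite_eq]
        split_ifs <;> ring
      have h2 : (∑ b : M, (if α e ∉ M ∧ β e = b then C e * f (α e) i * w e else 0) * g b j) =
          if α e ∉ M ∧ β e ∈ M then C e * f (α e) i * g (β e) j * w e else 0 := by
        rw [sum_coe_sort M
          (fun b => (if α e ∉ M ∧ β e = b then C e * f (α e) i * w e else 0) * g b j)]
        by_cases ha : α e ∈ M
        · simp [ha]
        · simp only [ha, not_false_eq_true, true_and, ite_mul, zero_mul, sum_ite_eq]
          split_ifs <;> ring
      rw [h1, h2]
      by_cases ha : α e ∈ M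
      · simp [ha]
      by_cases hb : β e ∈ M
      · simp [ha, hb]
      rcases eq_or_ne (C e) 0 with hC | hC
      · simp [hC]
      · have hc : γ e ∈ M := by simpa [ha, hb] using hM e hC
        simp [w, ha, hb, horth _ hc]
    rw [hL, sum_congr rfl fun e _ => hterm e, sum_add_distrib, Matrix.mul_apply,
      Fintype.sum_sum_type]
    congr 1
    · rw [sum_comm]
      refine sum_congr rfl fun a _ => ?_
      simp [A, B, mul_sum]
    · rw [sum_comm]
      refine sum_congr rfl fun b _ => ?_
      simp [A, B, sum_mul]
  have hrank : #{s | v s ≠ 0} ≤ 2 * #M := by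
    have h1 := Matrix.rank_diagonal v
    rw [Fintype.card_subtype] at h1
    rw [← h1, hAB]
    refine (Matrix.rank_mul_le_left A B).trans ((Matrix.rank_le_card_width A).trans ?_)
    simp [two_mul]
  omega

/-! ### Tri-coloured sum-free sets -/

/-- Exponent vectors of monomials in the variables `ι` with individual degrees below `p` and
total degree at most `(p - 1) |ι| / 3`. -/
def lowDegreeExponents (p : ℕ) (ι : Type*) [Fintype ι] [DecidableEq ι] : Finset (ι → Fin p) :=
  {a | 3 * ∑ l, (a l : ℕ) ≤ (p - 1) * Fintype.card ι}

/-- Weighting each monomial by `x ^ degree` for `0 < x < 1` bounds the number of those of low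
degree (a Chernoff bound). -/
theorem card_lowDegreeExponents_le_rateFun_pow {p : ℕ} (hp : 1 ≤ p) (ι : Type*) [Fintype ι]
    [DecidableEq ι] {x : ℝ} (hx : x ∈ Set.Ioo (0 : ℝ) 1) :
    (#(lowDegreeExponents p ι) : ℝ) ≤ rateFun p x ^ Fintype.card ι := by
  obtain ⟨h0, h1⟩ := hx
  have hsum : (∑ i ∈ range p, x ^ i) ^ Fintype.card ι =
      ∑ a : ι → Fin p, x ^ (∑ l, (a l : ℕ)) := by
    rw [← Fin.sum_univ_eq_sum_range (fun i => x ^ i), ← card_univ, ← prod_const,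
      prod_univ_sum, Fintype.piFinset_univ]
    exact sum_congr rfl fun a _ => prod_pow_eq_pow_sum _ _ _
  rw [rateFun, mul_pow, hsum, ← Real.rpow_natCast, ← Real.rpow_mul h0.le, mul_sum,
    card_eq_sum_ones, Nat.cast_sum]
  refine (sum_le_sum fun a ha => ?_).trans
    (sum_le_sum_of_subset_of_nonneg (subset_univ _) fun a _ _ => by positivity)
  rw [Nat.cast_one, ← Real.rpow_natCast, ← Real.rpow_add h0]
  refine Real.one_le_rpow_of_pos_of_le_one_of_nonpos h0 h1.le ?_
  have ha' : 3 * ∑ l, (a l : ℕ) ≤ (p - 1) * Fintype.card ι := by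
    simpa [lowDegreeExponents] using ha
  have ha'' : (3 : ℝ) * ((∑ l, (a l : ℕ) : ℕ) : ℝ) ≤ ((p : ℝ) - 1) * Fintype.card ι := by
    have := (Nat.cast_le (α := ℝ)).2 ha'
    rwa [Nat.cast_mul, Nat.cast_mul, Nat.cast_sub hp, Nat.cast_one, Nat.cast_ofNat] at this
  linarith

theorem card_lowDegreeExponents_le {p : ℕ} (hp : 2 ≤ p) (ι : Type*) [Fintype ι]
    [DecidableEq ι] :
    (#(lowDegreeExponents p ι) : ℝ) ≤ rateInf p ^ Fintype.card ι := by
  have hR := one_lt_rateInf hp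
  rcases Nat.eq_zero_or_pos (Fintype.card ι) with h | h
  · have := card_lowDegreeExponents_le_rateFun_pow (p := p) (by omega) ι
      (x := 1 / 2) ⟨by norm_num, by norm_num⟩
    rwa [h, pow_zero] at this ⊢
  · have hroot : (#(lowDegreeExponents p ι) : ℝ) ^ ((Fintype.card ι : ℝ)⁻¹) ≤ rateInf p := by
      refine (isGLB_rateInf hp).2 ?_
      rintro _ ⟨x, hx, rfl⟩
      have hpos := rateFun_lower hp hx
      have := card_lowDegreeExponents_le_rateFun_pow (p := p) (by omega) ι hx
      calc _ ≤ (rateFun p x ^ Fintype.card ι) ^ ((Fintype.card ι : ℝ)⁻¹) := by gcongr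
        _ = rateFun p x := Real.pow_rpow_inv_natCast (by linarith) h.ne'
    calc (#(lowDegreeExponents p ι) : ℝ)
        = ((#(lowDegreeExponents p ι) : ℝ) ^ ((Fintype.card ι : ℝ)⁻¹)) ^ Fintype.card ι :=
          (Real.rpow_inv_natCast_pow (by positivity) h.ne').symm
      _ ≤ _ := by gcongr

/-- The indicator of `a + b + c = 0` on `𝔽_p` is a polynomial in `a, b, c` of total degree
at most `p - 1`. -/
theorem exists_coeff_indicator_add_eq_zero (p : ℕ) [Fact p.Prime] :
    ∃ C : Fin p × Fin p × Fin p → ZMod p,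
      (∀ t, C t ≠ 0 → (t.1 : ℕ) + t.2.1 + t.2.2 ≤ p - 1) ∧
      ∀ a b c : ZMod p, (if a + b + c = 0 then 1 else 0) =
        ∑ t, C t * a ^ (t.1 : ℕ) * b ^ (t.2.1 : ℕ) * c ^ (t.2.2 : ℕ) := by
  have hp := (Fact.out : p.Prime).two_le
  have expand : ∀ (q : ℕ) (_ : q < p) (u v : ZMod p),
      (u + v) ^ q = ∑ s : Fin p, if (s : ℕ) ≤ q then
        u ^ (s : ℕ) * v ^ (q - s) * (q.choose s : ZMod p) else 0 := by
    intro q hq u v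
    rw [add_pow, Fin.sum_univ_eq_sum_range
      (fun s => if s ≤ q then u ^ s * v ^ (q - s) * (q.choose s : ZMod p) else 0), ← sum_filter]
    refine sum_congr ?_ fun _ _ => rfl
    ext s
    simp
    omega
  have single : ∀ (q : ℕ) (_ : q < p) (u : ZMod p),
      u ^ q = ∑ t : Fin p, if (t : ℕ) = q then u ^ (t : ℕ) else 0 := by
    intro q hq u
    rw [Fin.sum_univ_eq_sum_range (fun t => if t = q then u ^ t else 0)]
    simp [hq]
  -- The coefficients of `1 - (a + b + c) ^ (p - 1)`, by Fermat's little theorem.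
  refine ⟨fun t => (if (t.1 : ℕ) = 0 ∧ (t.2.1 : ℕ) = 0 ∧ (t.2.2 : ℕ) = 0 then 1 else 0) -
    if (t.1 : ℕ) + t.2.1 + t.2.2 = p - 1 then
      ((p - 1).choose t.1 : ZMod p) * ((p - 1 - t.1).choose t.2.1 : ZMod p) else 0, ?_, ?_⟩
  · intro t ht
    by_contra! hlt
    refine ht ?_
    dsimp only
    rw [if_neg (by omega), if_neg (by omega), sub_zero]
  · intro a b c
    have hL : (if a + b + c = 0 then (1 : ZMod p) else 0) = 1 - (a + (b + c)) ^ (p - 1) := by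
      rw [← add_assoc]
      split_ifs with h
      · rw [h, zero_pow (by omega), sub_zero]
      · rw [ZMod.pow_card_sub_one_eq_one h, sub_self]
    have h1 : (1 : ZMod p) = ∑ t : Fin p × Fin p × Fin p,
        (if (t.1 : ℕ) = 0 ∧ (t.2.1 : ℕ) = 0 ∧ (t.2.2 : ℕ) = 0 then 1 else 0) *
          a ^ (t.1 : ℕ) * b ^ (t.2.1 : ℕ) * c ^ (t.2.2 : ℕ) := by
      let z : Fin p := ⟨0, by omega⟩
      rw [Fintype.sum_eq_single (z, z, z)]
      · simp [z]
      · intro t ht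
        rw [if_neg]
        · simp
        · rintro ⟨h1, h2, h3⟩
          exact ht (Prod.ext (Fin.ext h1) (Prod.ext (Fin.ext h2) (Fin.ext h3)))
    rw [hL]
    simp only [sub_mul, sum_sub_distrib]
    rw [← h1]
    congr 1
    rw [expand _ (by omega), Fintype.sum_prod_type]
    refine sum_congr rfl fun s _ => ?_
    split_ifs with hs
    · rw [expand _ (by omega), Fintype.sum_prod_type, mul_sum, sum_mul]
      refine sum_congr rfl fun t _ => ?_
      split_ifs with ht
      · rw [single (p - 1 - s - t) (by omega) c]
        simp only [mul_sum, sum_mul]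
        refine sum_congr rfl fun r _ => ?_
        by_cases hr : (s : ℕ) + t + r = p - 1
        · rw [if_pos hr, if_pos (by omega)]
          ring
        · rw [if_neg hr, if_neg (by omega)]
          ring
      · rw [mul_zero, zero_mul]
        refine (sum_eq_zero fun r _ => ?_).symm
        rw [if_neg (by dsimp only; omega)]
        ring
    · rw [Fintype.sum_prod_type]
      refine (sum_eq_zero fun t _ => sum_eq_zero fun r _ => ?_).symm
      rw [if_neg (by dsimp only; omega)]
      ring

/-- A tri-coloured sum-free set in `𝔽_p ^ ι` has at most `3 · (rateInf p) ^ |ι|` elements. -/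
theorem card_le_of_add_eq_zero_iff {p : ℕ} [Fact p.Prime] {ι S : Type*} [Fintype ι]
    [Fintype S] (x y z : S → ι → ZMod p)
    (h : ∀ i j k, x i + y j + z k = 0 ↔ i = j ∧ j = k) :
    (Fintype.card S : ℝ) ≤ 3 * rateInf p ^ Fintype.card ι := by
  classical
  have hp := (Fact.out : p.Prime).two_le
  obtain ⟨C, hC, hsum⟩ := exists_coeff_indicator_add_eq_zero p
  let mono : (ι → Fin p) → (ι → ZMod p) → ZMod p := fun a u => ∏ l, u l ^ (a l : ℕ)
  have key : Fintype.card S ≤ 3 * #(lowDegreeExponents p ι) := by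
    refine card_le_three_mul_of_diagonal_eq_sum (E := ι → Fin p × Fin p × Fin p)
      (lowDegreeExponents p ι) (fun e => ∏ l, C (e l)) (fun e l => (e l).1)
      (fun e l => (e l).2.1) (fun e l => (e l).2.2) (fun a i => mono a (x i))
      (fun b j => mono b (y j)) (fun c k => mono c (z k)) ?_ ?_
    · -- The three degrees sum to at most `(p - 1) |ι|`, so one is at most a third of it.
      intro e he
      have hdeg : ∑ l, (((e l).1 : ℕ) + (e l).2.1 + (e l).2.2) ≤ (p - 1) * Fintype.card ι := by
        have := sum_le_card_nsmul univ (fun l => ((e l).1 : ℕ) + (e l).2.1 + (e l).2.2) (p - 1)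
          fun l _ => hC _ fun h0 => he (prod_eq_zero (mem_univ l) h0)
        rwa [card_univ, smul_eq_mul, mul_comm] at this
      rw [sum_add_distrib, sum_add_distrib] at hdeg
      simp only [lowDegreeExponents, mem_filter, mem_univ, true_and]
      omega
    · intro i j k
      have hind : (if i = j ∧ j = k then (1 : ZMod p) else 0) =
          ∏ l, if x i l + y j l + z k l = 0 then 1 else 0 := by
        simp [prod_ite_zero, ← h, funext_iff]
      rw [hind, prod_congr rfl fun l _ => hsum _ _ _, prod_univ_sum, Fintype.piFinset_univ]
      refine sum_congr rfl fun e _ => ?_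
      simp only [mono, prod_mul_distrib]
  calc (Fintype.card S : ℝ) ≤ 3 * #(lowDegreeExponents p ι) := by exact_mod_cast key
    _ ≤ _ := by gcongr; exact card_lowDegreeExponents_le hp ι

/-! ### Triangles of bounded degree, by restriction to random affine subspaces -/

theorem mem_trianglesIn {V : Type*} [AddCommGroup V] {X Y Z : Finset V} {t : V × V × V} :
    t ∈ trianglesIn X Y Z ↔
      (t.1 ∈ X ∧ t.2.1 ∈ Y ∧ t.2.2 ∈ Z) ∧ t.1 + t.2.1 + t.2.2 = 0 := by
  simp [trianglesIn, IsTriangle]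

/-- For `u ≠ 0`, the value `A *ᵥ u` of a uniformly random matrix `A` is uniformly distributed. -/
theorem card_mulVec_eq_mul_card {F ι κ : Type*} [Field F] [Fintype F] [DecidableEq F]
    [Fintype ι] [DecidableEq ι] [Fintype κ] [DecidableEq κ] {u : ι → F} (hu : u ≠ 0)
    (w : κ → F) :
    #{A : Matrix κ ι F | A.mulVec u = w} * Fintype.card (κ → F) =
      Fintype.card (Matrix κ ι F) := by
  obtain ⟨l, hl⟩ := Function.ne_iff.1 hu
  let φ : Matrix κ ι F →+ (κ → F) :=
    { toFun := fun A => A.mulVec u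
      map_zero' := Matrix.zero_mulVec u
      map_add' := fun A B => Matrix.add_mulVec A B u }
  have hsurj : Function.Surjective φ := fun w' => by
    refine ⟨Matrix.vecMulVec w' (Pi.single l (u l)⁻¹), ?_⟩
    ext k
    have hl' : u l ≠ 0 := hl
    simp [φ, Matrix.mulVec, Matrix.vecMulVec_apply, dotProduct, Pi.single_apply, hl']
  rw [← card_univ (α := Matrix κ ι F),
    card_eq_sum_card_fiberwise (s := univ) (f := φ) (t := univ) (fun _ _ => mem_univ _),
    sum_congr rfl fun w' _ => AddMonoidHom.card_fiber_eq_of_mem_range φ (hsurj w') (hsurj w),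
    sum_const, card_univ, smul_eq_mul, mul_comm]
  rfl

section Sampling

variable {F V ι κ : Type*} [Field F] [AddCommGroup V] [Fintype ι]

/-- The map `v = (u, w) ↦ w - A u`, whose fibres are the translates of the graph of `A`. -/
def graphDefect (e : V ≃+ (ι → F) × (κ → F)) (A : Matrix κ ι F) : V →+ (κ → F) where
  toFun v := (e v).2 - A.mulVec (e v).1
  map_zero' := by simp
  map_add' v w := by simp [Matrix.mulVec_add]; abel

theorem graphDefect_apply (e : V ≃+ (ι → F) × (κ → F)) (A : Matrix κ ι F) (v : V) :
    graphDefect e A v = (e v).2 - A.mulVec (e v).1 := rfl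

theorem card_graphDefect_eq_zero_mul_le [Fintype F] [DecidableEq F] [DecidableEq ι] [Fintype κ]
    [DecidableEq κ] (e : V ≃+ (ι → F) × (κ → F)) {v : V} (hv : v ≠ 0) :
    #{A : Matrix κ ι F | graphDefect e A v = 0} * Fintype.card (κ → F) ≤
      Fintype.card (Matrix κ ι F) := by
  rcases eq_or_ne (e v).1 0 with h | h
  · have h2 : (e v).2 ≠ 0 := fun h2 => hv (by
      rw [← e.map_eq_zero_iff]; exact Prod.ext h h2)
    simp [graphDefect_apply, h, h2]
  · rw [← card_mulVec_eq_mul_card h (e v).2]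
    simp only [graphDefect_apply, sub_eq_zero, eq_comm (a := (e v).2), le_refl]

/-- A triangle `t ∈ T` is isolated for `A` if no other triangle of `T` that shares a point with
`t` lies in the same translates of the graph of `A` as `t` does. The third points need no
condition, since the points of a triangle sum to zero. -/
def IsIsolated (e : V ≃+ (ι → F) × (κ → F)) (T : Finset (V × V × V)) (A : Matrix κ ι F)
    (t : V × V × V) : Prop :=
  ∀ s ∈ T, (s.1 = t.1 ∨ s.2.1 = t.2.1 ∨ s.2.2 = t.2.2) →
    graphDefect e A s.1 = graphDefect e A t.1 →
    graphDefect e A s.2.1 = graphDefect e A t.2.1 → s = t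

open Classical in
/-- The isolated triangles in given translates of the graph of `A` form a tri-coloured sum-free
set in `𝔽_p ^ ι`. -/
theorem card_isIsolated_fiber_le {p : ℕ} [Fact p.Prime]
    (e : V ≃+ (ι → ZMod p) × (κ → ZMod p)) (X Y Z : Finset V) (A : Matrix κ ι (ZMod p))
    (a b : κ → ZMod p) :
    (#{t ∈ trianglesIn X Y Z | IsIsolated e (trianglesIn X Y Z) A t ∧
      graphDefect e A t.1 = a ∧ graphDefect e A t.2.1 = b} : ℝ) ≤
      3 * rateInf p ^ Fintype.card ι := by
  set I : Finset (V × V × V) := {t ∈ trianglesIn X Y Z | IsIsolated e (trianglesIn X Y Z) A t ∧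
      graphDefect e A t.1 = a ∧ graphDefect e A t.2.1 = b} with hI
  have hmem : ∀ t : I, t.1 ∈ trianglesIn X Y Z ∧ IsIsolated e (trianglesIn X Y Z) A t ∧
      graphDefect e A t.1.1 = a ∧ graphDefect e A t.1.2.1 = b := fun t => by
    simpa only [hI, mem_filter] using t.2
  rw [← Fintype.card_coe I]
  refine card_le_of_add_eq_zero_iff (fun t : I => (e t.1.1).1) (fun t => (e t.1.2.1).1)
    (fun t => (e t.1.2.2).1) fun i j k => ⟨fun h => ?_, ?_⟩
  · obtain ⟨hi, hiI, hia, hib⟩ := hmem i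
    obtain ⟨hj, hjI, hja, hjb⟩ := hmem j
    obtain ⟨hk, hkI, hka, hkb⟩ := hmem k
    rw [mem_trianglesIn] at hi hj hk
    have hkc : graphDefect e A k.1.2.2 = -(a + b) := by
      rw [eq_neg_of_add_eq_zero_right hk.2, map_neg, map_add, hka, hkb]
    have h0 : graphDefect e A (i.1.1 + j.1.2.1 + k.1.2.2) = 0 := by
      rw [map_add, map_add, hia, hjb, hkc, add_neg_cancel]
    have h1 : (e (i.1.1 + j.1.2.1 + k.1.2.2)).1 = 0 := by
      simpa using h
    have hv : i.1.1 + j.1.2.1 + k.1.2.2 = 0 := by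
      rw [graphDefect_apply, h1, Matrix.mulVec_zero, sub_zero] at h0
      rw [← e.map_eq_zero_iff]
      exact Prod.ext h1 h0
    have hs : (i.1.1, j.1.2.1, k.1.2.2) ∈ trianglesIn X Y Z :=
      mem_trianglesIn.2 ⟨⟨hi.1.1, hj.1.2.1, hk.1.2.2⟩, hv⟩
    have ei := hiI _ hs (Or.inl rfl) rfl (hjb.trans hib.symm)
    have ej := hjI _ hs (Or.inr (Or.inl rfl)) (hia.trans hja.symm) rfl
    have ek := hkI _ hs (Or.inr (Or.inr rfl)) (hia.trans hka.symm) (hjb.trans hkb.symm)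
    exact ⟨Subtype.ext (ei.symm.trans ej), Subtype.ext (ej.symm.trans ek)⟩
  · rintro ⟨rfl, rfl⟩
    have := congrArg (fun v => (e v).1) (mem_trianglesIn.1 (hmem i).1).2
    simpa using this

open Classical in
/-- If every point lies in at most `d` triangles, a triangle fails to be isolated for at most
a fraction `3 d / |F| ^ |κ|` of all matrices. -/
theorem card_not_isIsolated_mul_le [Fintype F] [Fintype κ] (e : V ≃+ (ι → F) × (κ → F))
    (X Y Z : Finset V) {d : ℕ}
    (h1 : ∀ v, #{t ∈ trianglesIn X Y Z | t.1 = v} ≤ d)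
    (h2 : ∀ v, #{t ∈ trianglesIn X Y Z | t.2.1 = v} ≤ d)
    (h3 : ∀ v, #{t ∈ trianglesIn X Y Z | t.2.2 = v} ≤ d)
    {t : V × V × V} (ht : t ∈ trianglesIn X Y Z) :
    #{A : Matrix κ ι F | ¬ IsIsolated e (trianglesIn X Y Z) A t} * Fintype.card (κ → F) ≤
      3 * d * Fintype.card (Matrix κ ι F) := by
  set T := trianglesIn X Y Z with hT
  let N : Finset (V × V × V) :=
    {s ∈ T | (s.1 = t.1 ∨ s.2.1 = t.2.1 ∨ s.2.2 = t.2.2) ∧ s ≠ t}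
  have hN : #N ≤ 3 * d := by
    have hsub : N ⊆ {s ∈ T | s.1 = t.1} ∪ ({s ∈ T | s.2.1 = t.2.1} ∪
        {s ∈ T | s.2.2 = t.2.2}) := by
      intro s hs
      simp only [N, mem_filter, mem_union] at hs ⊢
      tauto
    have := (card_le_card hsub).trans
      ((card_union_le _ _).trans (Nat.add_le_add_left (card_union_le _ _) _))
    have := h1 t.1
    have := h2 t.2.1
    have := h3 t.2.2
    omega
  -- A nonzero vector on which `graphDefect` vanishes if `s` spoils the isolation of `t`.
  let δ : V × V × V → V := fun s => if s.1 = t.1 then s.2.1 - t.2.1 else s.1 - t.1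
  have hδ : ∀ s ∈ N, δ s ≠ 0 := by
    intro s hs h0
    simp only [N, mem_filter] at hs
    have hs3 := (mem_trianglesIn.1 hs.1).2
    have ht3 := (mem_trianglesIn.1 ht).2
    by_cases hs1 : s.1 = t.1
    · have hs2 : s.2.1 = t.2.1 := by simpa [δ, hs1, sub_eq_zero] using h0
      refine hs.2.2 (Prod.ext hs1 (Prod.ext hs2 ?_))
      rw [eq_neg_of_add_eq_zero_right hs3, eq_neg_of_add_eq_zero_right ht3, hs1, hs2]
    · simp [δ, hs1, sub_eq_zero] at h0
  have hcover : ({A : Matrix κ ι F | ¬ IsIsolated e T A t} : Finset _) ⊆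
      N.biUnion fun s => {A : Matrix κ ι F | graphDefect e A (δ s) = 0} := by
    intro A hA
    replace hA := (mem_filter.1 hA).2
    unfold IsIsolated at hA
    push Not at hA
    obtain ⟨s, hs, hshare, ha, hb, hne⟩ := hA
    simp only [mem_biUnion, mem_filter, mem_univ, true_and, N]
    refine ⟨s, ⟨hs, hshare, hne⟩, ?_⟩
    by_cases hs1 : s.1 = t.1
    · simp [δ, hs1, hb]
    · simp [δ, hs1, ha]
  calc _ ≤ (∑ s ∈ N, #{A : Matrix κ ι F | graphDefect e A (δ s) = 0}) *
        Fintype.card (κ → F) :=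
        Nat.mul_le_mul_right _ ((card_le_card hcover).trans card_biUnion_le)
    _ = ∑ s ∈ N, #{A : Matrix κ ι F | graphDefect e A (δ s) = 0} * Fintype.card (κ → F) :=
        sum_mul _ _ _
    _ ≤ #N * Fintype.card (Matrix κ ι F) :=
        sum_le_card_nsmul _ _ _ fun s hs => card_graphDefect_eq_zero_mul_le e (hδ s hs)
    _ ≤ _ := Nat.mul_le_mul_right _ hN

open Classical in
/-- The bound from sampling, by double counting of the pairs of a matrix and a triangle isolated
for it: the translates give `p ^ (2 |κ|)` fibres for each matrix, and each fibre holds few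
isolated triangles. -/
theorem card_trianglesIn_mul_le {p : ℕ} [Fact p.Prime] [Fintype κ]
    (e : V ≃+ (ι → ZMod p) × (κ → ZMod p)) (X Y Z : Finset V) {d : ℕ}
    (h1 : ∀ v, #{t ∈ trianglesIn X Y Z | t.1 = v} ≤ d)
    (h2 : ∀ v, #{t ∈ trianglesIn X Y Z | t.2.1 = v} ≤ d)
    (h3 : ∀ v, #{t ∈ trianglesIn X Y Z | t.2.2 = v} ≤ d) :
    (#(trianglesIn X Y Z) : ℝ) * (1 - 3 * d / (p : ℝ) ^ Fintype.card κ) ≤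
      3 * ((p : ℝ) ^ Fintype.card κ) ^ 2 * rateInf p ^ Fintype.card ι := by
  set T := trianglesIn X Y Z with hT
  have hcardκ : Fintype.card (κ → ZMod p) = p ^ Fintype.card κ := by
    rw [Fintype.card_fun, ZMod.card]
  have hp0 : (0 : ℝ) < p := by exact_mod_cast (Fact.out : p.Prime).pos
  set P : ℝ := (p : ℝ) ^ Fintype.card κ with hP
  have hP0 : 0 < P := by positivity
  set m : ℝ := (Fintype.card (Matrix κ ι (ZMod p)) : ℝ) with hm
  have hm0 : 0 < m := Nat.cast_pos.2 Fintype.card_pos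
  have hlow : ∀ t ∈ T, m * (1 - 3 * d / P) ≤
      #{A : Matrix κ ι (ZMod p) | IsIsolated e T A t} := by
    intro t ht
    have hbad := card_not_isIsolated_mul_le e X Y Z h1 h2 h3 ht
    have hsplit := card_filter_add_card_filter_not (s := (univ : Finset (Matrix κ ι (ZMod p))))
      (fun A => IsIsolated e T A t)
    rw [card_univ] at hsplit
    rw [hcardκ] at hbad
    have hbad' := (Nat.cast_le (α := ℝ)).2 hbad
    have hsplit' := congrArg (Nat.cast : ℕ → ℝ) hsplit
    push_cast at hbad' hsplit'
    rw [← le_div_iff₀ hP0] at hbad'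
    have : m * (1 - 3 * d / P) = m - 3 * d * m / P := by ring
    linarith
  have hup : ∀ A : Matrix κ ι (ZMod p), (#{t ∈ T | IsIsolated e T A t} : ℝ) ≤
      P ^ 2 * (3 * rateInf p ^ Fintype.card ι) := by
    intro A
    rw [card_eq_sum_card_fiberwise
      (f := fun t : V × V × V => (graphDefect e A t.1, graphDefect e A t.2.1)) (t := univ)
      (fun _ _ => mem_univ _), Nat.cast_sum]
    refine (sum_le_card_nsmul _ _ (3 * rateInf p ^ Fintype.card ι) fun ab _ => ?_).trans_eq ?_
    · refine (Nat.cast_le.2 (card_le_card fun t ht => ?_)).trans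
        (card_isIsolated_fiber_le e X Y Z A ab.1 ab.2)
      simpa [Prod.ext_iff, and_assoc] using ht
    · rw [card_univ, Fintype.card_prod, hcardκ, nsmul_eq_mul]
      push_cast
      ring
  have hcount : ∑ t ∈ T, #{A : Matrix κ ι (ZMod p) | IsIsolated e T A t} =
      ∑ A : Matrix κ ι (ZMod p), #{t ∈ T | IsIsolated e T A t} :=
    sum_card_bipartiteAbove_eq_sum_card_bipartiteBelow (fun t A => IsIsolated e T A t)
  have hmain : #T * (m * (1 - 3 * d / P)) ≤ m * (P ^ 2 * (3 * rateInf p ^ Fintype.card ι)) :=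
    calc #T * (m * (1 - 3 * d / P))
        ≤ ∑ t ∈ T, (#{A : Matrix κ ι (ZMod p) | IsIsolated e T A t} : ℝ) := by
          rw [← nsmul_eq_mul]
          exact card_nsmul_le_sum _ _ _ hlow
      _ = ∑ A : Matrix κ ι (ZMod p), (#{t ∈ T | IsIsolated e T A t} : ℝ) := by
          exact_mod_cast hcount
      _ ≤ _ := by
          refine (sum_le_card_nsmul _ _ _ fun A _ => hup A).trans_eq ?_
          rw [card_univ, nsmul_eq_mul]
  refine le_of_mul_le_mul_left ?_ hm0
  linarith

end Sampling

open Classical in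
/-- If every point lies in at most `d` triangles then, up to a constant factor, there are at most
`N ^ (1 - c) * d ^ (1 + c)` triangles, where `N` is the number of points of the space. -/
theorem card_trianglesIn_le_of_degree_le {p : ℕ} [Fact p.Prime] {V : Type*} [AddCommGroup V]
    [Module (ZMod p) V] [Fintype V] (X Y Z : Finset V) {d : ℕ} (hd : 1 ≤ d)
    (h1 : ∀ v, #{t ∈ trianglesIn X Y Z | t.1 = v} ≤ d)
    (h2 : ∀ v, #{t ∈ trianglesIn X Y Z | t.2.1 = v} ≤ d)
    (h3 : ∀ v, #{t ∈ trianglesIn X Y Z | t.2.2 = v} ≤ d) :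
    (#(trianglesIn X Y Z) : ℝ) ≤
      216 * (p : ℝ) ^ 2 * (Fintype.card V : ℝ) ^ (1 - smallC p) * (d : ℝ) ^ (1 + smallC p) := by
  have hp := (Fact.out : p.Prime).two_le
  have hpR : (2 : ℝ) ≤ p := by exact_mod_cast hp
  have hdR : (1 : ℝ) ≤ d := by exact_mod_cast hd
  obtain ⟨hc0, hc1⟩ := smallC_mem_Ioo hp
  have hR := rpow_one_sub_smallC hp
  set c := smallC p with hc
  set n := Module.finrank (ZMod p) V with hn
  have hN : (Fintype.card V : ℝ) = (p : ℝ) ^ n := by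
    rw [Module.card_eq_pow_finrank (K := ZMod p), ZMod.card, Nat.cast_pow]
  rw [hN]
  -- With `6 d ≤ p ^ k < 6 d p`, at least half of the surviving triangles are isolated.
  set k := Nat.clog p (6 * d) with hk
  have hk1 : 6 * d ≤ p ^ k := Nat.le_pow_clog (by omega) _
  have hk2 : p ^ (k - 1) < 6 * d := Nat.pow_pred_clog_lt_self (by omega) (by omega)
  have hk0 : k ≠ 0 := by
    intro h
    rw [h, pow_zero] at hk1
    omega
  have hk1' : 6 * (d : ℝ) ≤ (p : ℝ) ^ k := by exact_mod_cast hk1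
  have hk2' : (p : ℝ) ^ (k - 1) ≤ 6 * d := by exact_mod_cast hk2.le
  have hNpos : (0 : ℝ) < (p : ℝ) ^ n := by positivity
  rcases le_or_gt k n with hkn | hkn
  · have hfr : Module.finrank (ZMod p) V =
        Module.finrank (ZMod p) ((Fin (n - k) → ZMod p) × (Fin k → ZMod p)) := by
      rw [Module.finrank_prod, Module.finrank_fin_fun, Module.finrank_fin_fun]
      omega
    have hmain := card_trianglesIn_mul_le (LinearEquiv.ofFinrankEq _ _ hfr).toAddEquiv
      X Y Z h1 h2 h3
    rw [Fintype.card_fin, Fintype.card_fin, ← hR] at hmain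
    have hhalf : (1 / 2 : ℝ) ≤ 1 - 3 * d / (p : ℝ) ^ k := by
      have : 3 * (d : ℝ) / (p : ℝ) ^ k ≤ 1 / 2 := by
        rw [div_le_iff₀ (by positivity)]
        linarith
      linarith
    have hpk : (p : ℝ) ^ k ≤ 6 * p * d := by
      calc (p : ℝ) ^ k = (p : ℝ) ^ (k - 1) * p := (pow_sub_one_mul hk0 _).symm
        _ ≤ 6 * d * p := by gcongr
        _ = _ := by ring
    have hexp : ((p : ℝ) ^ k) ^ 2 * ((p : ℝ) ^ (1 - c)) ^ (n - k) =
        ((p : ℝ) ^ n) ^ (1 - c) * ((p : ℝ) ^ k) ^ (1 + c) := by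
      have hp0 : (0 : ℝ) < p := by linarith
      simp only [← Real.rpow_natCast]
      simp only [← Real.rpow_mul hp0.le, ← Real.rpow_add hp0]
      congr 1
      push_cast [hkn]
      ring
    have h6 : ((p : ℝ) ^ k) ^ (1 + c) ≤ 36 * (p : ℝ) ^ 2 * (d : ℝ) ^ (1 + c) := by
      calc ((p : ℝ) ^ k) ^ (1 + c) ≤ (6 * p * d) ^ (1 + c) := by gcongr
        _ = (6 * p : ℝ) ^ (1 + c) * (d : ℝ) ^ (1 + c) :=
            Real.mul_rpow (by positivity) (by positivity)
        _ ≤ (6 * p : ℝ) ^ (2 : ℝ) * (d : ℝ) ^ (1 + c) := by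
            gcongr <;> linarith
        _ = _ := by
            rw [Real.rpow_two]
            ring
    have hT : (#(trianglesIn X Y Z) : ℝ) * (1 / 2) ≤
        3 * (((p : ℝ) ^ n) ^ (1 - c) * (36 * (p : ℝ) ^ 2 * (d : ℝ) ^ (1 + c))) :=
      calc _ ≤ (#(trianglesIn X Y Z) : ℝ) * (1 - 3 * d / (p : ℝ) ^ k) := by gcongr
        _ ≤ 3 * (((p : ℝ) ^ k) ^ 2 * ((p : ℝ) ^ (1 - c)) ^ (n - k)) := by
            rw [← mul_assoc]
            exact hmain
        _ ≤ _ := by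
            rw [hexp]
            gcongr
    linarith
  · -- Here `|V| < 6 d`, and counting triangles by their first points is enough.
    have hTN : (#(trianglesIn X Y Z) : ℝ) ≤ (p : ℝ) ^ n * d := by
      rw [← hN]
      have : #(trianglesIn X Y Z) ≤ Fintype.card V * d := by
        rw [card_eq_sum_card_fiberwise (f := fun t : V × V × V => t.1) (t := univ)
          (fun _ _ => mem_univ _), ← card_univ, ← smul_eq_mul]
        exact sum_le_card_nsmul _ _ _ fun v _ => h1 v
      exact_mod_cast this
    have hn6 : (p : ℝ) ^ n ≤ 6 * d :=
      (pow_le_pow_right₀ (by linarith) (by omega)).trans hk2'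
    calc (#(trianglesIn X Y Z) : ℝ) ≤ (p : ℝ) ^ n * d := hTN
      _ = ((p : ℝ) ^ n) ^ (1 - c) * (((p : ℝ) ^ n) ^ c * d) := by
          rw [← mul_assoc, ← Real.rpow_add hNpos, sub_add_cancel, Real.rpow_one]
      _ ≤ ((p : ℝ) ^ n) ^ (1 - c) * ((6 * d : ℝ) ^ c * d) := by gcongr
      _ = (6 : ℝ) ^ c * (((p : ℝ) ^ n) ^ (1 - c) * (d : ℝ) ^ (1 + c)) := by
          rw [Real.mul_rpow (by norm_num) (by linarith), Real.rpow_add (by linarith) 1 c,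
            Real.rpow_one]
          ring
      _ ≤ (216 * (p : ℝ) ^ 2) * (((p : ℝ) ^ n) ^ (1 - c) * (d : ℝ) ^ (1 + c)) := by
          gcongr
          calc (6 : ℝ) ^ c ≤ (6 : ℝ) ^ (1 : ℝ) :=
                Real.rpow_le_rpow_of_exponent_le (by norm_num) hc1.le
            _ ≤ _ := by
                rw [Real.rpow_one]
                nlinarith
      _ = _ := by ring

/-! ### Removing points of maximum degree -/

/-- By concavity of `S ↦ S ^ (c / (1 + c))`, a lower bound `(S / A) ^ (1 / (1 + c)) ≤ d` on the
decrease of `S` turns into a constant decrease of `S ^ (c / (1 + c))`. -/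
theorem rpow_sub_add_le_rpow {A S d c : ℝ} (hA : 0 < A) (hS : 0 < S) (hd : 0 ≤ d) (hdS : d ≤ S)
    (hc : 0 < c) (h : S ≤ A * d ^ (1 + c)) :
    (S - d) ^ (c / (1 + c)) + c / (1 + c) * A ^ (-(1 / (1 + c))) ≤ S ^ (c / (1 + c)) := by
  have hc1 : 0 < 1 + c := by linarith
  have hroot : A ^ (-(1 / (1 + c))) ≤ d * S ^ (-(1 / (1 + c))) := by
    have h1 : (S / A) ^ (1 / (1 + c)) ≤ d := by
      calc (S / A) ^ (1 / (1 + c)) ≤ (d ^ (1 + c)) ^ (1 / (1 + c)) := by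
            gcongr
            rwa [div_le_iff₀' hA]
        _ = d := by rw [← Real.rpow_mul hd, mul_one_div_cancel hc1.ne', Real.rpow_one]
    rw [Real.div_rpow hS.le hA.le, div_le_iff₀ (by positivity)] at h1
    rw [Real.rpow_neg hA.le, Real.rpow_neg hS.le, ← div_eq_mul_inv, le_div_iff₀ (by positivity),
      inv_mul_le_iff₀ (by positivity)]
    linarith
  have hbern : (S - d) ^ (c / (1 + c)) ≤ S ^ (c / (1 + c)) * (1 + c / (1 + c) * -(d / S)) := by
    have h1 : S - d = S * (1 + -(d / S)) := by field_simp; ring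
    have h2 : d / S ≤ 1 := (div_le_one hS).2 hdS
    rw [h1, Real.mul_rpow hS.le (by linarith)]
    gcongr
    exact rpow_one_add_le_one_add_mul_self (by linarith) (by positivity)
      ((div_le_one hc1).2 (by linarith))
  have hS' : S ^ (c / (1 + c)) / S = S ^ (-(1 / (1 + c))) := by
    rw [← Real.rpow_sub_one hS.ne']
    congr 1
    field_simp
    ring
  calc _ ≤ S ^ (c / (1 + c)) * (1 + c / (1 + c) * -(d / S)) +
        c / (1 + c) * (d * S ^ (-(1 / (1 + c)))) := by gcongr
    _ = S ^ (c / (1 + c)) := by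
        rw [← hS']
        ring

section Matching

variable {p : ℕ} [Fact p.Prime] {V : Type*} [AddCommGroup V] [Module (ZMod p) V] [Fintype V]

open Classical in
/-- A family of `|M|` disjoint triangles forces many triangles. Deleting a point of maximum
degree `d` destroys exactly `d` triangles, but only one triangle of `M`. -/
theorem card_mul_le_card_trianglesIn_rpow (X Y Z : Finset V) (M : Finset (V × V × V))
    (hM : M ⊆ trianglesIn X Y Z) (hdisj : ∀ s ∈ M, ∀ t ∈ M, s ≠ t → TriangleDisjoint s t) :
    #M * (smallC p / (1 + smallC p) *
        (216 * (p : ℝ) ^ 2 * (Fintype.card V : ℝ) ^ (1 - smallC p)) ^ (-(1 / (1 + smallC p)))) ≤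
      (#(trianglesIn X Y Z) : ℝ) ^ (smallC p / (1 + smallC p)) := by
  have hp0 : (0 : ℝ) < p := by exact_mod_cast (Fact.out : p.Prime).pos
  obtain ⟨hc0, -⟩ := smallC_mem_Ioo (Fact.out : p.Prime).two_le
  have hN0 : (0 : ℝ) < Fintype.card V := Nat.cast_pos.2 Fintype.card_pos
  have hA : 0 < 216 * (p : ℝ) ^ 2 * (Fintype.card V : ℝ) ^ (1 - smallC p) := by positivity
  obtain ⟨m, hm⟩ : ∃ m, m = #M := ⟨_, rfl⟩
  induction m generalizing X Y Z M with
  | zero =>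
    rw [← hm, Nat.cast_zero, zero_mul]
    positivity
  | succ m ih =>
    set T := trianglesIn X Y Z with hT
    obtain ⟨t₀, ht₀⟩ : M.Nonempty := card_pos.1 (by omega)
    have step : ∀ (π : V × V × V → V) (v : V) (X' Y' Z' : Finset V),
        trianglesIn X' Y' Z' = {t ∈ T | π t ≠ v} →
        (∀ s t, TriangleDisjoint s t → π s ≠ π t) →
        (∀ w, #{t ∈ T | t.1 = w} ≤ #{t ∈ T | π t = v}) →
        (∀ w, #{t ∈ T | t.2.1 = w} ≤ #{t ∈ T | π t = v}) →
        (∀ w, #{t ∈ T | t.2.2 = w} ≤ #{t ∈ T | π t = v}) →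
        #M * (smallC p / (1 + smallC p) *
          (216 * (p : ℝ) ^ 2 * (Fintype.card V : ℝ) ^ (1 - smallC p)) ^
            (-(1 / (1 + smallC p)))) ≤ (#T : ℝ) ^ (smallC p / (1 + smallC p)) := by
      intro π v X' Y' Z' hT' hπ h1 h2 h3
      have hd1 : 1 ≤ #{t ∈ T | π t = v} := by
        refine le_trans ?_ (h1 t₀.1)
        exact card_pos.2 ⟨t₀, mem_filter.2 ⟨hM ht₀, rfl⟩⟩
      have hcard : #{t ∈ T | π t = v} + #(trianglesIn X' Y' Z') = #T := by
        rw [hT']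
        exact card_filter_add_card_filter_not _
      have hreg := card_trianglesIn_le_of_degree_le (p := p) X Y Z hd1 h1 h2 h3
      have hone : #{t ∈ M | π t = v} ≤ 1 := by
        refine card_le_one.2 fun s hs t ht => ?_
        rw [mem_filter] at hs ht
        by_contra hne
        exact hπ s t (hdisj s hs.1 t ht.1 hne) (hs.2.trans ht.2.symm)
      have hsplit : #{t ∈ M | π t = v} + #{t ∈ M | π t ≠ v} = #M :=
        card_filter_add_card_filter_not _
      obtain ⟨M', hM', hM'card⟩ :=
        exists_subset_card_eq (s := {t ∈ M | π t ≠ v}) (n := m) (by omega)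
      have hM'T : M' ⊆ trianglesIn X' Y' Z' := by
        rw [hT']
        exact hM'.trans (filter_subset_filter _ hM)
      have hrec := ih X' Y' Z' M' hM'T
        (fun s hs t ht => hdisj s (mem_filter.1 (hM' hs)).1 t (mem_filter.1 (hM' ht)).1)
        hM'card.symm
      have hcard' : (#(trianglesIn X' Y' Z') : ℝ) = #T - #{t ∈ T | π t = v} := by
        rw [← hcard]
        push_cast
        ring
      rw [hM'card, hcard'] at hrec
      have hdec := rpow_sub_add_le_rpow hA (S := #T) (d := #{t ∈ T | π t = v})
        (by exact_mod_cast (by omega : 0 < #T)) (Nat.cast_nonneg _)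
        (by exact_mod_cast (by omega : #{t ∈ T | π t = v} ≤ #T)) hc0 hreg
      rw [← hm]
      push_cast
      linarith
    obtain ⟨v1, h1⟩ : ∃ v, ∀ w, #{t ∈ T | t.1 = w} ≤ #{t ∈ T | t.1 = v} :=
      Finite.exists_max _
    obtain ⟨v2, h2⟩ : ∃ v, ∀ w, #{t ∈ T | t.2.1 = w} ≤ #{t ∈ T | t.2.1 = v} :=
      Finite.exists_max _
    obtain ⟨v3, h3⟩ : ∃ v, ∀ w, #{t ∈ T | t.2.2 = w} ≤ #{t ∈ T | t.2.2 = v} :=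
      Finite.exists_max _
    have e1 : trianglesIn (X.erase v1) Y Z = {t ∈ T | t.1 ≠ v1} := by
      ext t
      simp only [hT, mem_trianglesIn, mem_filter, mem_erase]
      tauto
    have e2 : trianglesIn X (Y.erase v2) Z = {t ∈ T | t.2.1 ≠ v2} := by
      ext t
      simp only [hT, mem_trianglesIn, mem_filter, mem_erase]
      tauto
    have e3 : trianglesIn X Y (Z.erase v3) = {t ∈ T | t.2.2 ≠ v3} := by
      ext t
      simp only [hT, mem_trianglesIn, mem_filter, mem_erase]
      tauto
    rcases le_total #{t ∈ T | t.1 = v1} #{t ∈ T | t.2.1 = v2} with h12 | h12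
    · rcases le_total #{t ∈ T | t.2.1 = v2} #{t ∈ T | t.2.2 = v3} with h23 | h23
      · exact step _ v3 _ _ _ e3 (fun _ _ h => h.2.2) (fun w => (h1 w).trans (h12.trans h23))
          (fun w => (h2 w).trans h23) h3
      · exact step _ v2 _ _ _ e2 (fun _ _ h => h.2.1) (fun w => (h1 w).trans h12) h2
          (fun w => (h3 w).trans h23)
    · rcases le_total #{t ∈ T | t.1 = v1} #{t ∈ T | t.2.2 = v3} with h13 | h13
      · exact step _ v3 _ _ _ e3 (fun _ _ h => h.2.2) (fun w => (h1 w).trans h13)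
          (fun w => (h2 w).trans (h12.trans h13)) h3
      · exact step _ v1 _ _ _ e1 (fun _ _ h => h.1) h1 (fun w => (h2 w).trans h12)
          (fun w => (h3 w).trans h13)

/-- The triangle removal bound up to a constant factor that depends on `p` only. -/
theorem const_mul_le_card_trianglesIn (X Y Z : Finset V) (M : Finset (V × V × V))
    (hM : M ⊆ trianglesIn X Y Z) (hdisj : ∀ s ∈ M, ∀ t ∈ M, s ≠ t → TriangleDisjoint s t) :
    (smallC p / (1 + smallC p)) ^ bigC p * (216 * (p : ℝ) ^ 2) ^ (-(1 / smallC p)) *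
        ((#M : ℝ) ^ bigC p * (Fintype.card V : ℝ) ^ (1 - 1 / smallC p)) ≤
      #(trianglesIn X Y Z) := by
  have hp0 : (0 : ℝ) < p := by exact_mod_cast (Fact.out : p.Prime).pos
  have h := card_mul_le_card_trianglesIn_rpow (p := p) X Y Z M hM hdisj
  obtain ⟨hc0, -⟩ := smallC_mem_Ioo (Fact.out : p.Prime).two_le
  have hN0 : (0 : ℝ) < Fintype.card V := Nat.cast_pos.2 Fintype.card_pos
  have hK0 : 0 < 216 * (p : ℝ) ^ 2 := by positivity
  rw [bigC]
  set c := smallC p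
  generalize 216 * (p : ℝ) ^ 2 = K at *
  have hc1 : 0 < 1 + c := by linarith
  have hpow := Real.rpow_le_rpow (by positivity) h (by positivity : 0 ≤ 1 + 1 / c)
  rw [← Real.rpow_mul (by positivity), show c / (1 + c) * (1 + 1 / c) = 1 by field_simp; ring,
    Real.rpow_one] at hpow
  refine le_of_eq_of_le ?_ hpow
  rw [Real.mul_rpow (by positivity) (by positivity), Real.mul_rpow (by positivity) (by positivity),
    ← Real.rpow_mul (by positivity),
    show -(1 / (1 + c)) * (1 + 1 / c) = -(1 / c) by field_simp; ring,
    Real.mul_rpow (by positivity) (by positivity), ← Real.rpow_mul hN0.le,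
    show (1 - c) * -(1 / c) = 1 - 1 / c by field_simp; ring]
  ring

/-! ### Tensor power -/

open Classical in
/-- Applying the bound with a constant to all powers of a configuration removes the constant. -/
theorem rpow_mul_rpow_le_card_trianglesIn (X Y Z : Finset V) (M : Finset (V × V × V))
    (hM : M ⊆ trianglesIn X Y Z) (hdisj : ∀ s ∈ M, ∀ t ∈ M, s ≠ t → TriangleDisjoint s t) :
    (#M : ℝ) ^ bigC p * (Fintype.card V : ℝ) ^ (1 - 1 / smallC p) ≤ #(trianglesIn X Y Z) := by
  have hp0 : (0 : ℝ) < p := by exact_mod_cast (Fact.out : p.Prime).pos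
  obtain ⟨hc0, -⟩ := smallC_mem_Ioo (Fact.out : p.Prime).two_le
  set K := (smallC p / (1 + smallC p)) ^ bigC p * (216 * (p : ℝ) ^ 2) ^ (-(1 / smallC p)) with hK
  have hK0 : 0 < K := by positivity
  set q := (#M : ℝ) ^ bigC p * (Fintype.card V : ℝ) ^ (1 - 1 / smallC p) with hq
  have hpow : ∀ k : ℕ, K * q ^ k ≤ (#(trianglesIn X Y Z) : ℝ) ^ k := by
    intro k
    let f : (Fin k → V × V × V) → (Fin k → V) × (Fin k → V) × (Fin k → V) :=
      fun s => (fun i => (s i).1, fun i => (s i).2.1, fun i => (s i).2.2)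
    have hf : Function.Injective f := by
      intro s s' h
      simp only [f, Prod.mk.injEq, funext_iff] at h
      exact funext fun i => Prod.ext (h.1 i) (Prod.ext (h.2.1 i) (h.2.2 i))
    let X' : Finset (Fin k → V) := Fintype.piFinset fun _ => X
    let Y' : Finset (Fin k → V) := Fintype.piFinset fun _ => Y
    let Z' : Finset (Fin k → V) := Fintype.piFinset fun _ => Z
    have hT : trianglesIn X' Y' Z' =
        (Fintype.piFinset fun _ : Fin k => trianglesIn X Y Z).image f := by
      ext t
      simp only [mem_trianglesIn, mem_image, Fintype.mem_piFinset, X', Y', Z', f]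
      constructor
      · rintro ⟨⟨h1, h2, h3⟩, h0⟩
        exact ⟨fun i => (t.1 i, t.2.1 i, t.2.2 i),
          fun i => ⟨⟨h1 i, h2 i, h3 i⟩, congrFun h0 i⟩, rfl⟩
      · rintro ⟨s, hs, rfl⟩
        exact ⟨⟨fun i => (hs i).1.1, fun i => (hs i).1.2.1, fun i => (hs i).1.2.2⟩,
          funext fun i => (hs i).2⟩
    have hbound := const_mul_le_card_trianglesIn (p := p) X' Y' Z'
      ((Fintype.piFinset fun _ : Fin k => M).image f)
      (by
        rw [hT]
        exact image_subset_image (Fintype.piFinset_subset _ _ fun _ => hM))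
      (by
        intro s hs t ht hne
        obtain ⟨s, hs', rfl⟩ := mem_image.1 hs
        obtain ⟨t, ht', rfl⟩ := mem_image.1 ht
        obtain ⟨i, hi⟩ := Function.ne_iff.1 fun h : s = t => hne (h ▸ rfl)
        rw [Fintype.mem_piFinset] at hs' ht'
        have := hdisj _ (hs' i) _ (ht' i) hi
        exact ⟨fun h => this.1 (congrFun h i), fun h => this.2.1 (congrFun h i),
          fun h => this.2.2 (congrFun h i)⟩)
    rw [hT, card_image_of_injective _ hf, card_image_of_injective _ hf, Fintype.card_piFinset,
      Fintype.card_piFinset, Fintype.card_fun, ← hK] at hbound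
    simp only [prod_const, card_univ, Fintype.card_fin, Nat.cast_pow] at hbound
    rwa [hq, mul_pow, Real.rpow_pow_comm (by positivity), Real.rpow_pow_comm (by positivity)]
  by_contra! hlt
  have hq0 : 0 < q := lt_of_le_of_lt (Nat.cast_nonneg _) hlt
  obtain ⟨k, hk⟩ := exists_pow_lt_of_lt_one hK0 ((div_lt_one hq0).2 hlt)
  rw [div_pow, div_lt_iff₀ (by positivity)] at hk
  exact absurd (hpow k) (not_le.2 hk)

end Matching

theorem theorem3 (p : ℕ) [Fact p.Prime] (n m : ℕ) (ε : ℝ)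
    (hm : (m : ℝ) = ε * (p : ℝ) ^ n)
    (x y z : Fin m → (Fin n → ZMod p))
    (htri : ∀ i, IsTriangle (x i, y i, z i))
    (hdisj : ∀ i j, i ≠ j → TriangleDisjoint (x i, y i, z i) (x j, y j, z j)) :
    ε ^ bigC p * ((p : ℝ) ^ n) ^ 2 ≤
      ((trianglesIn (Finset.univ.image x) (Finset.univ.image y)
        (Finset.univ.image z)).card : ℝ) := by
  classical
  have hp0 : (0 : ℝ) < p := by exact_mod_cast (Fact.out : p.Prime).pos
  have hN0 : (0 : ℝ) < (p : ℝ) ^ n := by positivity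
  have hinj : Function.Injective fun i => (x i, y i, z i) := by
    intro i j h
    by_contra hne
    exact (hdisj i j hne).1 (congrArg Prod.fst h)
  have hmain := rpow_mul_rpow_le_card_trianglesIn (p := p) (univ.image x) (univ.image y)
    (univ.image z) (univ.image fun i => (x i, y i, z i))
    (by
      intro t ht
      obtain ⟨i, -, rfl⟩ := mem_image.1 ht
      exact mem_trianglesIn.2 ⟨by simp, htri i⟩)
    (by
      intro s hs t ht hne
      obtain ⟨i, -, rfl⟩ := mem_image.1 hs
      obtain ⟨j, -, rfl⟩ := mem_image.1 ht
      exact hdisj i j fun h => hne (h ▸ rfl))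
  rw [card_image_of_injective _ hinj, card_univ, Fintype.card_fin, Fintype.card_fun, ZMod.card,
    Fintype.card_fin, Nat.cast_pow] at hmain
  refine le_of_eq_of_le ?_ hmain
  have hexp : ((p : ℝ) ^ n) ^ 2 =
      ((p : ℝ) ^ n) ^ bigC p * ((p : ℝ) ^ n) ^ (1 - 1 / smallC p) := by
    rw [← Real.rpow_add hN0, bigC, ← Real.rpow_two]
    congr 1
    ring
  have hε : ε = m / (p : ℝ) ^ n := by
    rw [hm, mul_div_cancel_right₀ _ hN0.ne']
  rw [hexp, ← mul_assoc, hε, Real.div_rpow (by positivity) hN0.le,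
    div_mul_cancel₀ _ (by positivity)]
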